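/- Let $\mathcal X,\mathcal A$ be finite nonempty sets, let $\mathcal P(\mathcal X)$ be the set of probability measures on $\mathcal X$, with $\|v\|_{\mathrm{TV}}=\sup_{S\subseteq\mathcal X}\big|\sum_{x\in S}v(x)\big|$ for signed measures $v$ on $\mathcal X$, and for $Q:\mathcal X\times\mathcal A\to\mathbb R$ put $\|Q\|_\infty=\sup_{x,a}|Q(x,a)|$. Let $p(\cdot\mid x,a,\mu)\in\mathcal P(\mathcal X)$ be a transition kernel depending on $(x,a,\mu)\in\mathcal X\times\mathcal A\times\mathcal P(\mathcal X)$, let $f:\mathcal X\times\mathcal A\times\mathcal P(\mathcal X)\to\mathbb R$ be a cost function, and let $h,\gamma>0$. Write $$P^{Q,\mu}(x,x')=p\big(x'\mid x,\operatorname{argmin}_a Q(x,a),\mu\big),\qquad (\mu P^{Q,\mu})(x)=\sum_{x_0\in\mathcal X}\mu(x_0)P^{Q,\mu}(x_0,x),$$ where $\operatorname{argmin}_aQ(x,a)$ denotes one minimizer, chosen by an arbitrary fixed rule. Call $\mu\in\mathcal P(\mathcal X)$ an equilibrium distribution for $Q$ if $\mu=\mu P^{Q,\mu}$. Assume: (Lipschitz)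 there are $0<L_p<1$ and $L_Q>0$ such that for all $x\in\mathcal X$, $\mu_1,\mu_2\in\mathcal P(\mathcal X)$ and $Q_1,Q_2:\mathcal X\times\mathcal A\to\mathbb R$, $$\sum_{x'\in\mathcal X}\big|P^{Q_1,\mu_1}(x,x')-P^{Q_2,\mu_2}(x,x')\big|\le L_p\|\mu_1-\mu_2\|_{\mathrm{TV}}+L_Q\|Q_1-Q_2\|_\infty .$$ (Uniform Doeblin) there is $\beta\in\big(\tfrac{1+L_p}{2},1\big)$ such that for every $Q:\mathcal X\times\mathcal A\to\mathbb R$ that has an equilibrium distribution, there are an equilibrium distribution $\pi$ for $Q$ and a probability measure $\nu$ on $\mathcal X$ with $P^{Q,\pi}(x,\cdot)\ge\beta\,\nu(\cdot)$ for all $x\in\mathcal X$. (The existence of an equilibrium distribution is not assumed.) Then for every $Q:\mathcal X\times\mathcal A\to\mathbb R$ there is a unique $\tilde\mu\in\mathcal P(\mathcal X)$ with $\tilde\mu=\tilde\mu P^{Q,\tilde\mu}$. If in addition (Cost) $f$ is bounded and there is $L_\mu>0$ such that $|f(x,a,\mu_1)-f(x,a,\mu_2)|\le L_\mu\|\mu_1-\mu_2\|_{\mathrm{TV}}$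 for all $(x,a)\in\mathcal X\times\mathcal A$ and $\mu_1,\mu_2\in\mathcal P(\mathcal X)$, then there exist $Q_h^*:\mathcal X\times\mathcal A\to\mathbb R$ and $\tilde\mu^*\in\mathcal P(\mathcal X)$ such that for all $(x,a)\in\mathcal X\times\mathcal A$ $$Q_h^*(x,a)=hf(x,a,\tilde\mu^*)+e^{-\gamma h}\sum_{x'\in\mathcal X}p(x'\mid x,a,\tilde\mu^*)\min_{a'\in\mathcal A}Q_h^*(x',a')\qquad\text{and}\qquad \tilde\mu^*=\tilde\mu^*P^{Q_h^*,\tilde\mu^*}.$$ -/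

import Mathlib

namespace MeanFieldQ

open scoped BigOperators

variable {X A : Type*} [Fintype X] [Fintype A]

/-- The total variation norm `sup_{S ⊆ X} |∑_{x ∈ S} v x|` of a signed measure on a finite set. -/
noncomputable def tvNorm (v : X → ℝ) : ℝ :=
  ⨆ S : Finset X, |∑ x ∈ S, v x|

/-- The total variation distance of two probability vectors. -/
noncomputable def tvDist (μ₁ μ₂ : stdSimplex ℝ X) : ℝ :=
  tvNorm fun x => μ₁ x - μ₂ x

/-- `α Q x` is an element of `argmin_a Q(x, a)`, for every `Q` and `x`
(a single-valued `argmin`, with an arbitrary rule for breaking ties). -/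
def IsArgmin (α : (X → A → ℝ) → X → A) : Prop :=
  ∀ (Q : X → A → ℝ) (x : X) (a : A), Q x (α Q x) ≤ Q x a

/-- `P^{Q,μ}(x, x') = p(x' | x, argmin_a Q(x,a), μ)`; here `p x a μ` is the probability vector
`p(· | x, a, μ)`. -/
def transition (p : X → A → stdSimplex ℝ X → stdSimplex ℝ X) (α : (X → A → ℝ) → X → A)
    (Q : X → A → ℝ) (μ : stdSimplex ℝ X) (x x' : X) : ℝ :=
  p x (α Q x) μ x'

/-- The stationarity equation `μ = μ P^{Q,μ}`. -/
def IsEquilibrium (p : X → A → stdSimplex ℝ X → stdSimplex ℝ X) (α : (X → A → ℝ) → X → A)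
    (Q : X → A → ℝ) (μ : stdSimplex ℝ X) : Prop :=
  ∀ x : X, μ x = ∑ x₀ : X, μ x₀ * transition p α Q μ x₀ x

/-- The Bellman equation
`Q(x,a) = h f(x,a,μ) + e^{-γh} ∑_{x'} p(x' | x,a,μ) min_{a'} Q(x',a')`. -/
def IsBellmanSolution (p : X → A → stdSimplex ℝ X → stdSimplex ℝ X)
    (f : X → A → stdSimplex ℝ X → ℝ) (h γ : ℝ)
    (Q : X → A → ℝ) (μ : stdSimplex ℝ X) : Prop :=
  ∀ (x : X) (a : A),
    Q x a = h * f x a μ + Real.exp (-(γ * h)) * ∑ x' : X, p x a μ x' * ⨅ a' : A, Q x' a'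

/-- The cost is bounded, and Lipschitz in the measure argument for the total variation norm. -/
def CostAssumption (f : X → A → stdSimplex ℝ X → ℝ) (Lμ : ℝ) : Prop :=
  0 < Lμ ∧
  (∃ C : ℝ, ∀ x a μ, |f x a μ| ≤ C) ∧
  ∀ x a μ₁ μ₂, |f x a μ₁ - f x a μ₂| ≤ Lμ * tvDist μ₁ μ₂

/-- Lipschitz continuity of `(Q, μ) ↦ P^{Q,μ}(x, ·)`. The norm of a function `X → A → ℝ` is
the sup norm over `X × A`. -/
def LipschitzAssumption (p : X → A → stdSimplex ℝ X → stdSimplex ℝ X)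
    (α : (X → A → ℝ) → X → A) (Lp LQ : ℝ) : Prop :=
  0 < Lp ∧ Lp < 1 ∧ 0 < LQ ∧
  ∀ (x : X) (μ₁ μ₂ : stdSimplex ℝ X) (Q₁ Q₂ : X → A → ℝ),
    ∑ x' : X, |transition p α Q₁ μ₁ x x' - transition p α Q₂ μ₂ x x'|
      ≤ Lp * tvDist μ₁ μ₂ + LQ * ‖Q₁ - Q₂‖

/-- Uniform Doeblin condition, with one constant `β ∈ ((1 + Lp)/2, 1)` for all `Q`: there are an
equilibrium `π = π P^{Q,π}` and a probability `ν` with `P^{Q,π}(x, ·) ≥ β ν` for all `x`.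
The mere existence of some equilibrium is not part of this condition: nothing is required of a `Q`
without one. -/
def DoeblinAssumption (p : X → A → stdSimplex ℝ X → stdSimplex ℝ X)
    (α : (X → A → ℝ) → X → A) (Lp β : ℝ) : Prop :=
  (1 + Lp) / 2 < β ∧ β < 1 ∧
  ∀ Q : X → A → ℝ, (∃ μ : stdSimplex ℝ X, IsEquilibrium p α Q μ) →
    ∃ π : stdSimplex ℝ X, IsEquilibrium p α Q π ∧
      ∃ ν : stdSimplex ℝ X, ∀ x x' : X, β * ν x' ≤ transition p α Q π x x'

end MeanFieldQ

/-! Both existence claims are Brouwer's theorem for the map `μ ↦ μ P^{q(μ),μ}` on the simplex, where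
`q` is continuous: constantly `Q` for the first claim, and for the second the fixed point of the
Bellman operator frozen at `μ`. That operator contracts with factor `e^{-γh} < 1` and varies
continuously with `μ`, hence so does its fixed point. An equilibrium found this way solves both
equations at once.

Uniqueness is a perturbation estimate in `ℓ¹` around the Doeblin equilibrium `π`: the minorization
contracts `μ - π` by `1 - β`, the dependence of the kernel on the measure costs at most `Lp / 2`,
and these add up to less than `1`.

Brouwer's theorem is derived from Scarf's lemma on dominant sets (`exists_dominant_rainbow`), a
parity argument that plays the role of Sperner's lemma without a triangulation. -/

/-! ### Dominant sets and Scarf's lemma. -/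

/-- `S` is dominant for the utilities `w i` when no `y` is strictly above the `w i`-minimum of `S`
for every index `i`. -/
def Dominant {I V L : Type*} [LinearOrder L] (w : I → V → L) (S : Finset V) : Prop :=
  ∀ y, ∃ i, ∀ x ∈ S, w i y ≤ w i x

theorem Finset.exists_eq_insert_of_subset_of_card {V : Type*} [DecidableEq V] {d r : Finset V}
    (hdr : d ⊆ r) (hc : d.card + 1 = r.card) : ∃ y ∉ d, r = insert y d := by
  have h1 : (r \ d).card = 1 := by
    rw [Finset.card_sdiff_of_subset hdr]; omega
  obtain ⟨y, hy⟩ := Finset.card_eq_one.1 h1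
  have hy' : y ∈ r \ d := by simp [hy]
  refine ⟨y, (Finset.mem_sdiff.1 hy').2, ?_⟩
  rw [Finset.insert_eq, ← hy, Finset.sdiff_union_of_subset hdr]

/-- The facets of a set of `n` points which carry all `n` colours but `i₀` are even in number,
unless the set carries all colours. -/
theorem even_card_rainbow_facets {I V : Type*} [Fintype I] [DecidableEq I] [DecidableEq V]
    (c : V → I) (i₀ : I) (r : Finset V) (hr : r.card = Fintype.card I)
    (hc : r.image c ≠ Finset.univ) (𝒟 : Finset (Finset V))
    (h𝒟 : ∀ d, d ⊆ r → (d ∈ 𝒟 ↔ d.image c = Finset.univ.erase i₀ ∧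
      d.card + 1 = Fintype.card I)) :
    Even (𝒟.filter (· ⊆ r)).card := by
  rcases (𝒟.filter (· ⊆ r)).eq_empty_or_nonempty with h | ⟨d, hd⟩
  · simp [h]
  obtain ⟨hd1, hdr⟩ := Finset.mem_filter.1 hd
  obtain ⟨himg, hcard⟩ := (h𝒟 d hdr).1 hd1
  have hinj : ∀ e : Finset V, e.image c = Finset.univ.erase i₀ → e.card + 1 = Fintype.card I →
      Set.InjOn c e := by
    intro e he hec
    apply Finset.card_image_iff.1
    rw [he, Finset.card_erase_of_mem (Finset.mem_univ _), Finset.card_univ]; omega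
  obtain ⟨x₀, hx₀, rfl⟩ := Finset.exists_eq_insert_of_subset_of_card hdr (by omega)
  have hcx : c x₀ ≠ i₀ := by
    intro h
    apply hc
    rw [Finset.image_insert, himg, h, Finset.insert_erase (Finset.mem_univ _)]
  have : c x₀ ∈ d.image c := by simp [himg, hcx]
  obtain ⟨x₁, hx₁, hx₁c⟩ := Finset.mem_image.1 this
  have hne : x₁ ≠ x₀ := fun h => hx₀ (h ▸ hx₁)
  -- The colours are injective on a facet in `𝒟`, so it must omit one of the two like-coloured
  -- points `x₀`, `x₁`.
  have key : 𝒟.filter (· ⊆ insert x₀ d) = {d, (insert x₀ d).erase x₁} := by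
    ext e
    simp only [Finset.mem_filter, Finset.mem_insert, Finset.mem_singleton]
    constructor
    · rintro ⟨he, her⟩
      obtain ⟨he1, he2⟩ := (h𝒟 e her).1 he
      obtain ⟨x, hx, hxe⟩ := Finset.exists_eq_insert_of_subset_of_card her (by omega)
      by_cases h0 : x = x₀
      · left
        rw [← Finset.erase_insert hx, ← hxe, h0, Finset.erase_insert hx₀]
      · by_cases h1 : x = x₁
        · right
          rw [hxe, h1, Finset.erase_insert (h1 ▸ hx)]
        · exfalso
          have m0 : x₀ ∈ e := by
            have : x₀ ∈ insert x e := hxe ▸ Finset.mem_insert_self _ _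
            exact (Finset.mem_insert.1 this).resolve_left (Ne.symm h0)
          have m1 : x₁ ∈ e := by
            have : x₁ ∈ insert x e := hxe ▸ Finset.mem_insert_of_mem hx₁
            exact (Finset.mem_insert.1 this).resolve_left (Ne.symm h1)
          exact hne (hinj e he1 he2 m1 m0 hx₁c)
    · rintro (rfl | rfl)
      · exact ⟨hd1, hdr⟩
      · refine ⟨(h𝒟 _ (Finset.erase_subset _ _)).2 ⟨?_, ?_⟩, Finset.erase_subset _ _⟩
        · rw [← himg]
          ext i
          simp only [Finset.mem_image, Finset.mem_erase, Finset.mem_insert]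
          constructor
          · rintro ⟨a, ⟨ha1, rfl | ha⟩, rfl⟩
            · exact ⟨x₁, hx₁, hx₁c⟩
            · exact ⟨a, ha, rfl⟩
          · rintro ⟨a, ha, rfl⟩
            by_cases h : a = x₁
            · exact ⟨x₀, ⟨hne.symm, Or.inl rfl⟩, by rw [h, hx₁c]⟩
            · exact ⟨a, ⟨h, Or.inr ha⟩, rfl⟩
        · rw [Finset.card_erase_of_mem (Finset.mem_insert_of_mem hx₁)]; omega
  rw [key, Finset.card_pair]
  · exact even_two
  · intro h
    have := h ▸ hx₁
    simp at this

section Scarf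

variable {I V L : Type*} [Fintype I] [DecidableEq I] [Fintype V] [DecidableEq V] [LinearOrder L]

/-- A dominant set with one element less than the number of orders lies in exactly two dominant
sets with one more element, provided that it can be extended in every direction. -/
theorem card_dominant_extensions_eq_two (w : I → V → L) (hw : ∀ i, Function.Injective (w i))
    {D : Finset V} (hne : D.Nonempty) (hD : Dominant w D) (hcard : D.card + 1 = Fintype.card I)
    (hext : ∀ k, ∃ y, ∀ l, l ≠ k → ∃ x ∈ D, w l x < w l y)
    (ℛ : Finset (Finset V)) (hℛ : ∀ r, r ∈ ℛ ↔ Dominant w r ∧ r.card = Fintype.card I) :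
    (ℛ.filter (D ⊆ ·)).card = 2 := by
  choose m hmD hm using fun l => D.exists_min_image (w l) hne
  have hsurj : ∀ x ∈ D, ∃ l, m l = x := by
    intro x hx
    obtain ⟨l, hl⟩ := hD x
    exact ⟨l, hw l (le_antisymm (hm l x hx) (hl _ (hmD l)))⟩
  -- There is one order more than there are points of `D`, and every point is the minimum of some
  -- order. So exactly two orders, `i` and `j`, share their minimum.
  obtain ⟨i, -, j, -, hij, hmij⟩ : ∃ i ∈ (Finset.univ : Finset I), ∃ j ∈ (Finset.univ : Finset I),
      i ≠ j ∧ m i = m j :=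
    Finset.exists_ne_map_eq_of_card_lt_of_maps_to (t := D) (by rw [Finset.card_univ]; omega)
      (fun l _ => hmD l)
  have hinj : ∀ k, (∀ x ∈ D, ∃ l, l ≠ k ∧ m l = x) →
      Set.InjOn m (Finset.univ.erase k : Finset I) := by
    intro k hk
    apply Finset.injOn_of_surjOn_of_card_le (t := D) m (fun l _ => hmD l)
    · intro x hx
      obtain ⟨l, hl, rfl⟩ := hk x hx
      exact ⟨l, by simpa using hl, rfl⟩
    · rw [Finset.card_erase_of_mem (Finset.mem_univ _), Finset.card_univ]; omega
  have hsurj' : ∀ k, (k = i ∨ k = j) → ∀ x ∈ D, ∃ l, l ≠ k ∧ m l = x := by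
    intro k hk x hx
    obtain ⟨l, rfl⟩ := hsurj x hx
    by_cases h : l = k
    · rcases hk with rfl | rfl
      · exact ⟨j, hij.symm, by rw [h, hmij]⟩
      · exact ⟨i, hij, by rw [h, hmij]⟩
    · exact ⟨l, h, rfl⟩
  -- The candidates for the added point: highest in order `k` among those above the minimum of `D`
  -- in every other order.
  have hmax : ∀ k, ∃ y, (∀ l, l ≠ k → w l (m l) < w l y) ∧
      ∀ z, (∀ l, l ≠ k → w l (m l) < w l z) → w k z ≤ w k y := by
    intro k
    classical
    obtain ⟨y, hy, hy'⟩ := (Finset.univ.filter fun y => ∀ l, l ≠ k → w l (m l) < w l y).exists_max_image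
      (w k) (by
        obtain ⟨y, hy⟩ := hext k
        refine ⟨y, Finset.mem_filter.2 ⟨Finset.mem_univ _, fun l hl => ?_⟩⟩
        obtain ⟨x, hx, hxy⟩ := hy l hl
        exact (hm l x hx).trans_lt hxy)
    exact ⟨y, (Finset.mem_filter.1 hy).2, fun z hz => hy' z (by simpa using hz)⟩
  choose y hyM hymax using hmax
  have hyD : ∀ k, (k = i ∨ k = j) → y k ∉ D := by
    intro k hk hyk
    obtain ⟨l, hl, hl'⟩ := hsurj' k hk _ hyk
    exact (hyM k l hl).ne (by rw [hl'])
  have hroom : ∀ k, (k = i ∨ k = j) → insert (y k) D ∈ ℛ := by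
    intro k hk
    refine (hℛ _).2 ⟨fun z => ?_, by rw [Finset.card_insert_of_notMem (hyD k hk), hcard]⟩
    by_cases hz : ∀ l, l ≠ k → w l (m l) < w l z
    · refine ⟨k, fun x hx => (hymax k z hz).trans ?_⟩
      rcases Finset.mem_insert.1 hx with rfl | hx2
      · exact le_rfl
      · obtain ⟨l, hl⟩ := hD (y k)
        by_cases hlk : l = k
        · subst hlk; exact hl x hx2
        · exact absurd (hl _ (hmD l)) (not_le.2 (hyM k l hlk))
    · push Not at hz
      obtain ⟨l, hl, hlz⟩ := hz
      refine ⟨l, fun x hx => ?_⟩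
      rcases Finset.mem_insert.1 hx with rfl | hx
      · exact hlz.trans (hyM k l hl).le
      · exact hlz.trans (hm l x hx)
  have hyij : y i ≠ y j := by
    intro h
    obtain ⟨l, hl⟩ := hD (y i)
    have h1 := hl _ (hmD l)
    by_cases hli : l = i
    · have hlj : l ≠ j := hli ▸ hij
      exact absurd h1 (not_le.2 (h ▸ hyM j l hlj))
    · exact absurd h1 (not_le.2 (hyM i l hli))
  have key : ℛ.filter (D ⊆ ·) = {insert (y i) D, insert (y j) D} := by
    ext r
    simp only [Finset.mem_filter, Finset.mem_insert, Finset.mem_singleton]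
    constructor
    · rintro ⟨hr, hDr⟩
      obtain ⟨hrd, hrc⟩ := (hℛ r).1 hr
      obtain ⟨z, hz, rfl⟩ := Finset.exists_eq_insert_of_subset_of_card hDr (by omega)
      obtain ⟨k, hk⟩ := hrd z
      -- The new point `z` is the minimum in order `k`, so the other orders must account for all of
      -- `D`. This forces `k` to be `i` or `j`.
      have hs : ∀ x ∈ D, ∃ l, l ≠ k ∧ m l = x ∧ w l x ≤ w l z := by
        intro x hx
        obtain ⟨l, hl⟩ := hrd x
        refine ⟨l, ?_, ?_, hl z (Finset.mem_insert_self _ _)⟩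
        · rintro rfl
          have := hw l (le_antisymm (hl z (Finset.mem_insert_self _ _))
            (hk x (Finset.mem_insert_of_mem hx)))
          exact hz (this ▸ hx)
        · exact hw l (le_antisymm (hm l x hx) (hl _ (Finset.mem_insert_of_mem (hmD l))))
      have hin := hinj k (fun x hx => by
        obtain ⟨l, h1, h2, -⟩ := hs x hx
        exact ⟨l, h1, h2⟩)
      have hkij : k = i ∨ k = j := by
        by_contra! hcon
        exact hij (hin (by simpa using hcon.1.symm) (by simpa using hcon.2.symm) hmij)
      have hzM : ∀ l, l ≠ k → w l (m l) < w l z := by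
        intro l hl
        obtain ⟨l', h1, h2, h3⟩ := hs (m l) (hmD l)
        have : l' = l := hin (by simpa using h1) (by simpa using hl) h2
        subst this
        exact lt_of_le_of_ne h3 fun h => hz (hw _ h ▸ hmD l')
      have hzy : z = y k := by
        apply hw k (le_antisymm (hymax k z hzM) _)
        obtain ⟨l, hl⟩ := hrd (y k)
        by_cases hlk : l = k
        · subst hlk; exact hl z (Finset.mem_insert_self _ _)
        · exact absurd (hl _ (Finset.mem_insert_of_mem (hmD l))) (not_le.2 (hyM k l hlk))
      rcases hkij with rfl | rfl
      · exact Or.inl (by rw [hzy])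
      · exact Or.inr (by rw [hzy])
    · rintro (rfl | rfl)
      · exact ⟨hroom i (Or.inl rfl), Finset.subset_insert _ _⟩
      · exact ⟨hroom j (Or.inr rfl), Finset.subset_insert _ _⟩
  rw [key, Finset.card_pair]
  intro h
  have : y i ∈ insert (y j) D := h ▸ Finset.mem_insert_self _ _
  rcases Finset.mem_insert.1 this with h | h
  · exact hyij h
  · exact hyD i (Or.inl rfl) h

/-- **Scarf's lemma** on dominant sets: `s i` is the least element of the `i`-th order and lies above
all the elements outside the range of `s` in the other orders. -/
theorem exists_dominant_rainbow (w : I → V → L) (hw : ∀ i, Function.Injective (w i))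
    (s : I → V) (hs : ∀ i v, v ≠ s i → w i (s i) < w i v)
    (hs' : ∀ i j v, j ≠ i → v ∉ Set.range s → w i v < w i (s j))
    {v₀ : V} (hv₀ : v₀ ∉ Set.range s) (c : V → I) (hc : ∀ i, c (s i) = i) :
    ∃ S : Finset V, Dominant w S ∧ S.card = Fintype.card I ∧ S.image c = Finset.univ := by
  classical
  by_contra! hcon
  have sinj : Function.Injective s := Function.LeftInverse.injective hc
  let i₀ : I := c v₀
  have hn : 0 < Fintype.card I := Fintype.card_pos_iff.2 ⟨i₀⟩
  have hsle : ∀ i v, w i (s i) ≤ w i v := fun i v => by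
    by_cases h : v = s i
    · rw [h]
    · exact (hs i v h).le
  let ℛ : Finset (Finset V) := Finset.univ.filter fun r => Dominant w r ∧ r.card = Fintype.card I
  let 𝒟 : Finset (Finset V) := Finset.univ.filter fun d =>
    Dominant w d ∧ d.image c = Finset.univ.erase i₀ ∧ d.card + 1 = Fintype.card I
  have hℛ : ∀ r, r ∈ ℛ ↔ Dominant w r ∧ r.card = Fintype.card I := fun r => by simp [ℛ]
  have h𝒟 : ∀ d, d ∈ 𝒟 ↔ Dominant w d ∧ d.image c = Finset.univ.erase i₀ ∧
    d.card + 1 = Fintype.card I := fun d => by simp [𝒟]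
  -- Double counting of the inclusions `d ⊆ r`: without a rainbow `r` each `r` contributes an even
  -- number, whereas on the other side `D₀` contributes one and every other `d` two.
  have hdc := Finset.sum_card_bipartiteAbove_eq_sum_card_bipartiteBelow (s := 𝒟) (t := ℛ) (· ⊆ ·)
  have hright : Even (∑ r ∈ ℛ, (𝒟.filter (· ⊆ r)).card) := by
    refine Finset.even_sum _ fun r hr => ?_
    obtain ⟨hr1, hr2⟩ := (hℛ r).1 hr
    refine even_card_rainbow_facets c i₀ r hr2 (hcon r hr1 hr2) 𝒟 fun d hd => ?_
    rw [h𝒟]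
    refine and_iff_right fun y => ?_
    obtain ⟨i, hi⟩ := hr1 y
    exact ⟨i, fun x hx => hi x (hd hx)⟩
  let D₀ : Finset V := (Finset.univ.erase i₀).image s
  have hD₀mem : ∀ l, l ≠ i₀ → s l ∈ D₀ := fun l hl => by simp [D₀, sinj.eq_iff, hl]
  have hD₀card : D₀.card + 1 = Fintype.card I := by
    rw [Finset.card_image_of_injective _ sinj, Finset.card_erase_of_mem (Finset.mem_univ _),
      Finset.card_univ]; omega
  have hD₀ : D₀ ∈ 𝒟 := by
    refine (h𝒟 _).2 ⟨fun y => ?_, ?_, hD₀card⟩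
    · by_cases hy : y ∈ Set.range s
      · obtain ⟨l, rfl⟩ := hy
        exact ⟨l, fun x _ => hsle l x⟩
      · refine ⟨i₀, fun x hx => ?_⟩
        obtain ⟨l, hl, rfl⟩ := Finset.mem_image.1 hx
        exact (hs' i₀ l y (Finset.ne_of_mem_erase hl) hy).le
    · rw [Finset.image_image]
      have : c ∘ s = id := funext hc
      rw [this, Finset.image_id]
  -- Adding `s i₀` would give the whole range of `s`, which `v₀` exceeds in every order. The added
  -- point is thus the `w i₀`-highest one outside that range.
  have hone : (ℛ.filter (D₀ ⊆ ·)).card = 1 := by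
    obtain ⟨y, hy, hymax⟩ := (Finset.univ.filter fun v => v ∉ Set.range s).exists_max_image (w i₀)
      ⟨v₀, by simpa using hv₀⟩
    have hy : y ∉ Set.range s := (Finset.mem_filter.1 hy).2
    have hyD : y ∉ D₀ := fun h => by
      obtain ⟨l, -, rfl⟩ := Finset.mem_image.1 h
      exact hy ⟨l, rfl⟩
    rw [Finset.card_eq_one]
    refine ⟨insert y D₀, ?_⟩
    ext r
    simp only [Finset.mem_filter, Finset.mem_singleton]
    constructor
    · rintro ⟨hr, hDr⟩
      obtain ⟨hrd, hrc⟩ := (hℛ r).1 hr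
      obtain ⟨z, hz, rfl⟩ := Finset.exists_eq_insert_of_subset_of_card hDr (by omega)
      have hzs : z ∉ Set.range s := by
        rintro ⟨l, rfl⟩
        have hl : l = i₀ := by_contra fun h => hz (hD₀mem l h)
        subst hl
        obtain ⟨i, hi⟩ := hrd v₀
        refine absurd (hi (s i) ?_) (not_le.2 (hs i v₀ fun h => hv₀ ⟨i, h.symm⟩))
        by_cases h : i = i₀
        · rw [h]; exact Finset.mem_insert_self _ _
        · exact Finset.mem_insert_of_mem (hD₀mem i h)
      obtain ⟨l, hl⟩ := hrd y
      have hli : l = i₀ := by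
        by_contra h
        exact absurd (hl (s l) (Finset.mem_insert_of_mem (hD₀mem l h)))
          (not_le.2 (hs l y fun h => hy ⟨l, h.symm⟩))
      subst hli
      rw [hw _ (le_antisymm (hl z (Finset.mem_insert_self _ _)) (hymax z (by simpa using hzs)))]
    · rintro rfl
      refine ⟨(hℛ _).2 ⟨fun z => ?_, by rw [Finset.card_insert_of_notMem hyD, hD₀card]⟩,
        Finset.subset_insert _ _⟩
      by_cases hz : z ∈ Set.range s
      · obtain ⟨l, rfl⟩ := hz
        exact ⟨l, fun x _ => hsle l x⟩
      · refine ⟨i₀, fun x hx => ?_⟩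
        rcases Finset.mem_insert.1 hx with rfl | hx
        · exact hymax z (by simpa using hz)
        · obtain ⟨l, hl, rfl⟩ := Finset.mem_image.1 hx
          exact (hs' i₀ l z (Finset.ne_of_mem_erase hl) hz).le
  have htwo : ∀ d ∈ 𝒟.erase D₀, Even (ℛ.filter (d ⊆ ·)).card := by
    intro d hd
    obtain ⟨hdne, hd⟩ := Finset.mem_erase.1 hd
    obtain ⟨hdd, hdi, hdc⟩ := (h𝒟 d).1 hd
    have hdn : d.Nonempty := by
      rw [Finset.nonempty_iff_ne_empty]
      rintro rfl
      apply hdne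
      symm
      rw [← Finset.card_eq_zero]
      simp at hdc; omega
    rw [card_dominant_extensions_eq_two w hw hdn hdd hdc (fun k => ⟨s k, fun l hl => ?_⟩) ℛ hℛ]
    · exact even_two
    -- If `s k` fails to extend `d` in order `l`, then `d` consists of all `s l'` with `l' ≠ l`, and
    -- its colours force `l = i₀`, that is `d = D₀`.
    by_contra! hx
    have hsub : d ⊆ (Finset.univ.erase l).image s := by
      intro x hxd
      have hxs : x ∈ Set.range s := by
        by_contra hxs
        exact absurd (hx x hxd) (not_le.2 (hs' l k x hl.symm hxs))
      obtain ⟨l', rfl⟩ := hxs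
      refine Finset.mem_image_of_mem _ (Finset.mem_erase.2 ⟨?_, Finset.mem_univ _⟩)
      rintro rfl
      exact absurd (hx _ hxd) (not_le.2 (hs l' (s k) fun h => hl (sinj h).symm))
    have heq : d = (Finset.univ.erase l).image s := by
      apply Finset.eq_of_subset_of_card_le hsub
      rw [Finset.card_image_of_injective _ sinj, Finset.card_erase_of_mem (Finset.mem_univ _),
        Finset.card_univ]; omega
    have hli : l = i₀ := by
      by_contra h
      have : i₀ ∈ d.image c := by
        rw [heq]
        exact Finset.mem_image.2 ⟨s i₀, by simp [sinj.eq_iff, Ne.symm h], hc _⟩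
      rw [hdi] at this
      simp at this
    exact hdne (by rw [heq, hli])
  have hleft : Odd (∑ d ∈ 𝒟, (ℛ.filter (d ⊆ ·)).card) := by
    rw [← Finset.add_sum_erase _ _ hD₀, hone]
    exact (Finset.even_sum _ htwo).one_add
  exact (Nat.not_even_iff_odd.2 hleft) (hdc ▸ hright)

end Scarf

/-! ### Brouwer's theorem on the simplex. -/

/-- A colouring of the grid points of the simplex of side `N` has a small multicoloured
cluster `σ`: every coordinate whose colour does not occur in `σ` is small on `σ`. -/
theorem exists_rainbow_cluster {I : Type*} [Fintype I] [Nonempty I] (N : ℕ)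
    (c : {v : I → Fin (N + 1) // ∑ i, (v i : ℕ) = N} → I) :
    ∃ σ : Finset {v : I → Fin (N + 1) // ∑ i, (v i : ℕ) = N}, σ.Nonempty ∧
      (∀ x ∈ σ, ∀ y ∈ σ, ∀ i, (x.1 i : ℕ) ≤ y.1 i + Fintype.card I) ∧
      ∀ i, (∃ x ∈ σ, c x = i) ∨ ∀ x ∈ σ, (x.1 i : ℕ) ≤ Fintype.card I := by
  classical
  let T := {v : I → Fin (N + 1) // ∑ i, (v i : ℕ) = N}
  -- Grid points are ordered by their coordinates, in `[0, N]`. The artificial vertex `j` lies below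
  -- all of them in order `j` (value `-1`) and above them in the others (`N + 1`). Ties are broken
  -- by the enumeration `e`.
  let ℓ : I → T ⊕ I → ℤ := fun i => Sum.elim (fun x => (x.1 i : ℤ))
    fun j => if j = i then -1 else N + 1
  let e := Fintype.equivFin (T ⊕ I)
  let w : I → T ⊕ I → ℤ ×ₗ Fin (Fintype.card (T ⊕ I)) := fun i v => toLex (ℓ i v, e v)
  have hw : ∀ i, Function.Injective (w i) := fun i v v' h =>
    e.injective (Prod.ext_iff.1 (toLex.injective h)).2
  have hlt : ∀ i v v', ℓ i v < ℓ i v' → w i v < w i v' := fun i v v' h =>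
    Prod.Lex.toLex_lt_toLex.2 (Or.inl h)
  have hle : ∀ i v v', w i v ≤ w i v' → ℓ i v ≤ ℓ i v' := fun i v v' h =>
    not_lt.1 fun h' => absurd (hlt i _ _ h') (not_lt.2 h)
  have hmk : ∀ y : I → ℕ, ∑ i, y i = N → ∃ x : T, ∀ i, (x.1 i : ℕ) = y i := by
    intro y hy
    refine ⟨⟨fun i => ⟨y i, ?_⟩, by simpa using hy⟩, fun i => rfl⟩
    have := Finset.single_le_sum (f := y) (fun i _ => Nat.zero_le _) (Finset.mem_univ i)
    omega
  obtain ⟨i₁⟩ := ‹Nonempty I›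
  obtain ⟨t₀, -⟩ := hmk (Pi.single i₁ N) (by simp)
  obtain ⟨S, hdom, -, himg⟩ := exists_dominant_rainbow w hw Sum.inr
    (by
      rintro i (x | j) hv
      · apply hlt
        simp only [ℓ, Sum.elim_inr, Sum.elim_inl, if_true]; omega
      · have : j ≠ i := fun h => hv (by rw [h])
        apply hlt
        simp only [ℓ, Sum.elim_inr, if_true, if_neg this]; omega)
    (by
      rintro i j (x | k) hj hv
      · apply hlt
        have := (x.1 i).2
        simp only [ℓ, Sum.elim_inr, Sum.elim_inl, if_neg hj]; omega
      · exact absurd ⟨k, rfl⟩ hv)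
    (v₀ := Sum.inl t₀) (by simp) (Sum.elim c id) (by simp)
  let σ : Finset T := Finset.univ.filter fun x => Sum.inl x ∈ S
  have hσ : ∀ x, x ∈ σ ↔ Sum.inl x ∈ S := fun x => by simp [σ]
  let C : Finset I := Finset.univ.filter fun i => Sum.inr i ∉ S
  have hC : ∀ i, i ∈ C ↔ Sum.inr i ∉ S := fun i => by simp [C]
  have hcol : ∀ i ∈ C, ∃ x ∈ σ, c x = i := by
    intro i hi
    have : i ∈ S.image (Sum.elim c id) := by rw [himg]; exact Finset.mem_univ _
    obtain ⟨x | j, hx, hxi⟩ := Finset.mem_image.1 this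
    · exact ⟨x, (hσ x).2 hx, hxi⟩
    · exact absurd ((show j = i from hxi) ▸ hx) ((hC i).1 hi)
  have hgrid : ∀ y : T, ∃ i ∈ C, ∀ x ∈ σ, (y.1 i : ℕ) ≤ x.1 i := by
    intro y
    obtain ⟨i, hi⟩ := hdom (Sum.inl y)
    refine ⟨i, (hC i).2 fun h => ?_, fun x hx => ?_⟩
    · have := hle i _ _ (hi _ h)
      simp only [ℓ, Sum.elim_inr, Sum.elim_inl, if_true] at this
      omega
    · have := hle i _ _ (hi _ ((hσ x).1 hx))
      simpa [ℓ] using this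
  obtain ⟨i₂, hi₂, -⟩ := hgrid t₀
  obtain ⟨x₂, hx₂, -⟩ := hcol i₂ hi₂
  have hσne : σ.Nonempty := ⟨x₂, hx₂⟩
  choose m hmσ hm using fun i => σ.exists_min_image (fun x => (x.1 i : ℕ)) hσne
  -- Otherwise some grid point exceeds the minima over `σ` in every coordinate of `C`, against
  -- dominance; the spare mass is put on `i₂`. Hence the minima leave a slack of less than `C.card`,
  -- which bounds all the spreads.
  have hsum : N < ∑ i ∈ C, (((m i).1 i : ℕ) + 1) := by
    by_contra! hcon
    set y : I → ℕ := fun i => (if i ∈ C then ((m i).1 i : ℕ) + 1 else 0) +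
      (if i = i₂ then N - ∑ i ∈ C, (((m i).1 i : ℕ) + 1) else 0) with hy
    obtain ⟨x, hx⟩ := hmk y (by
      rw [hy, Finset.sum_add_distrib, Finset.sum_ite_eq' Finset.univ i₂,
        ← Finset.sum_filter, Finset.filter_mem_eq_inter, Finset.univ_inter]
      simp only [Finset.mem_univ, if_true]
      omega)
    obtain ⟨i, hi, hi'⟩ := hgrid x
    have := hi' _ (hmσ i)
    rw [hx i] at this
    simp only [hy, if_pos hi] at this
    omega
  rw [Finset.sum_add_distrib, Finset.sum_const, smul_eq_mul, mul_one] at hsum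
  have hCn : C.card ≤ Fintype.card I := Finset.card_le_univ C
  have hsplit : ∀ x : T, ∑ i ∈ C, (x.1 i : ℕ) + ∑ i ∈ Cᶜ, (x.1 i : ℕ) = N := fun x => by
    rw [Finset.sum_add_sum_compl, x.2]
  have hin : ∀ x ∈ σ, ∀ i ∈ C, (x.1 i : ℕ) ≤ (m i).1 i + Fintype.card I := by
    intro x hx i hi
    have h1 := hsplit x
    have h2 : ∑ j ∈ C.erase i, ((m j).1 j : ℕ) ≤ ∑ j ∈ C.erase i, (x.1 j : ℕ) :=
      Finset.sum_le_sum fun j _ => hm j x hx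
    rw [← Finset.add_sum_erase C _ hi] at h1 hsum
    omega
  have hout : ∀ x ∈ σ, ∀ i, i ∉ C → (x.1 i : ℕ) ≤ Fintype.card I := by
    intro x hx i hi
    have h1 := hsplit x
    have h2 : ∑ j ∈ C, ((m j).1 j : ℕ) ≤ ∑ j ∈ C, (x.1 j : ℕ) :=
      Finset.sum_le_sum fun j _ => hm j x hx
    have h3 := Finset.single_le_sum (f := fun j => (x.1 j : ℕ)) (s := Cᶜ)
      (fun j _ => Nat.zero_le _) (Finset.mem_compl.2 hi)
    omega
  refine ⟨σ, hσne, fun x hx y hy i => ?_, fun i => ?_⟩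
  · by_cases hi : i ∈ C
    · exact (hin x hx i hi).trans (Nat.add_le_add_right (hm i y hy) _)
    · exact (hout x hx i hi).trans (Nat.le_add_left _ _)
  · by_cases hi : i ∈ C
    · exact Or.inl (hcol i hi)
    · exact Or.inr fun x hx => hout x hx i hi

/-- **Brouwer's fixed point theorem** on the standard simplex. -/
theorem stdSimplex.exists_isFixedPt {I : Type*} [Fintype I] [Nonempty I]
    (g : stdSimplex ℝ I → stdSimplex ℝ I) (hg : Continuous g) :
    ∃ z, Function.IsFixedPt g z := by
  classical
  have hcoord : ∀ i, Continuous fun z : stdSimplex ℝ I => z i := fun i =>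
    (continuous_apply i).comp continuous_subtype_val
  have happrox : ∀ η > 0, ∃ z : stdSimplex ℝ I, ∀ i, z i - g z i ≤ η := by
    intro η hη
    obtain ⟨δ, hδ, hδg⟩ := Metric.uniformContinuous_iff.1
      (CompactSpace.uniformContinuous_of_continuous hg) (η / 2) (half_pos hη)
    obtain ⟨N, hN⟩ := exists_nat_gt ((Fintype.card I : ℝ) / min δ (η / 2))
    have hmin : 0 < min δ (η / 2) := lt_min hδ (half_pos hη)
    have hN0 : (0 : ℝ) < N := lt_of_le_of_lt (by positivity) hN
    have hnN : (Fintype.card I : ℝ) / N < min δ (η / 2) := by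
      rw [div_lt_iff₀ hmin] at hN
      rw [div_lt_iff₀ hN0, mul_comm]
      exact hN
    let pt : {v : I → Fin (N + 1) // ∑ i, (v i : ℕ) = N} → stdSimplex ℝ I := fun v =>
      ⟨fun i => (v.1 i : ℕ) / (N : ℝ), fun i => by positivity, by
        rw [← Finset.sum_div, ← Nat.cast_sum, v.2, div_self hN0.ne']⟩
    have hpt : ∀ v i, pt v i = (v.1 i : ℕ) / (N : ℝ) := fun v i => rfl
    -- Both points have total mass one, so `g` cannot lower every coordinate; a non-lowered
    -- coordinate serves as the colour.
    have hcol : ∀ z : stdSimplex ℝ I, ∃ i, z i ≤ g z i := by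
      intro z
      by_contra! h
      have := Finset.sum_lt_sum_of_nonempty Finset.univ_nonempty fun i (_ : i ∈ Finset.univ) => h i
      simp [stdSimplex.sum_eq_one] at this
    choose c hc using fun v => hcol (pt v)
    obtain ⟨σ, ⟨x, hx⟩, hclose, hcover⟩ := exists_rainbow_cluster N c
    have hclose' : ∀ x ∈ σ, ∀ y ∈ σ, ∀ i, pt x i ≤ pt y i + Fintype.card I / N := by
      intro x hx y hy i
      rw [hpt, hpt, ← add_div]
      gcongr
      exact_mod_cast hclose x hx y hy i
    refine ⟨pt x, fun i => ?_⟩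
    rcases hcover i with ⟨y, hy, rfl⟩ | hi
    · have hdist : dist (pt x) (pt y) < δ := by
        refine lt_of_le_of_lt ?_ (hnN.trans_le (min_le_left _ _))
        rw [Subtype.dist_eq, dist_pi_le_iff (by positivity)]
        intro j
        rw [Real.dist_eq, abs_le]
        have h1 := hclose' x hx y hy j
        have h2 := hclose' y hy x hx j
        constructor
        · change _ ≤ pt x j - pt y j
          linarith
        · change pt x j - pt y j ≤ _
          linarith
      have h1 := (dist_le_pi_dist (g (pt x)).1 (g (pt y)).1 (c y)).trans_lt (hδg hdist)
      have h2 : |g (pt x) (c y) - g (pt y) (c y)| < η / 2 := h1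
      have h3 := (abs_lt.1 h2).1
      have h4 := hc y
      have h5 := hclose' x hx y hy (c y)
      have h6 := hnN.trans_le (min_le_right _ _)
      linarith
    · have h1 : pt x i ≤ Fintype.card I / N := by
        rw [hpt]
        gcongr
        exact_mod_cast hi x hx
      have h2 := stdSimplex.zero_le (g (pt x)) i
      have h6 := hnN.trans_le (min_le_right _ _)
      linarith
  let F : stdSimplex ℝ I → ℝ := fun z =>
    Finset.univ.sup' Finset.univ_nonempty fun i => z i - g z i
  have hF : Continuous F := Continuous.finset_sup'_apply _ fun i _ =>
    (hcoord i).sub ((hcoord i).comp hg)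
  obtain ⟨z, -, hz⟩ := isCompact_univ.exists_isMinOn Set.univ_nonempty hF.continuousOn
  have hFz : F z ≤ 0 := by
    refine le_of_forall_pos_le_add fun η hη => ?_
    obtain ⟨z', hz'⟩ := happrox η hη
    rw [zero_add]
    exact (hz (Set.mem_univ z')).trans (Finset.sup'_le _ _ fun i _ => hz' i)
  have hle : ∀ i ∈ Finset.univ, z i ≤ g z i := fun i hi =>
    sub_nonpos.1 ((Finset.le_sup' (fun i => z i - g z i) hi).trans hFz)
  -- Coordinatewise inequality between vectors of equal sum is equality.
  refine ⟨z, DFunLike.ext _ _ fun i => ?_⟩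
  exact ((Finset.sum_eq_sum_iff_of_le hle).1
    (by rw [stdSimplex.sum_eq_one, stdSimplex.sum_eq_one]) i (Finset.mem_univ i)).symm

/-! ### Total variation and continuity. -/

namespace MeanFieldQ

open scoped Topology
open Filter

variable {X A : Type*} [Fintype X] [Fintype A]

theorem tvNorm_le_iff {v : X → ℝ} {b : ℝ} : tvNorm v ≤ b ↔ ∀ S : Finset X, |∑ x ∈ S, v x| ≤ b :=
  ciSup_le_iff (Set.finite_range _).bddAbove

theorem tvNorm_nonneg (v : X → ℝ) : 0 ≤ tvNorm v :=
  (abs_nonneg _).trans (tvNorm_le_iff.1 le_rfl ∅)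

/-- The sums of `v` over `S` and over its complement are opposite, so each is at most half the `ℓ¹`
norm. -/
theorem two_mul_tvNorm_le {v : X → ℝ} (hv : ∑ x, v x = 0) : 2 * tvNorm v ≤ ∑ x, |v x| := by
  classical
  suffices tvNorm v ≤ (∑ x, |v x|) / 2 by linarith
  refine tvNorm_le_iff.2 fun S => ?_
  have h1 := Finset.sum_add_sum_compl S v
  have h2 := Finset.sum_add_sum_compl S fun x => |v x|
  have h3 := Finset.abs_sum_le_sum_abs v S
  have h4 := Finset.abs_sum_le_sum_abs v Sᶜ
  have h5 : |∑ x ∈ Sᶜ, v x| = |∑ x ∈ S, v x| := by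
    rw [← abs_neg]; congr 1; linarith
  linarith

theorem tvDist_le_card_mul_dist (μ₁ μ₂ : stdSimplex ℝ X) :
    tvDist μ₁ μ₂ ≤ Fintype.card X * dist μ₁ μ₂ := by
  refine tvNorm_le_iff.2 fun S => (Finset.abs_sum_le_sum_abs _ S).trans ?_
  calc ∑ x ∈ S, |μ₁ x - μ₂ x| ≤ ∑ x, |μ₁ x - μ₂ x| :=
        Finset.sum_le_univ_sum_of_nonneg fun _ => abs_nonneg _
    _ ≤ ∑ _x : X, dist μ₁ μ₂ := Finset.sum_le_sum fun x _ => dist_le_pi_dist μ₁.1 μ₂.1 x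
    _ = Fintype.card X * dist μ₁ μ₂ := by simp

theorem tendsto_tvDist (μ₀ : stdSimplex ℝ X) :
    Tendsto (fun μ => tvDist μ μ₀) (𝓝 μ₀) (𝓝 0) := by
  refine squeeze_zero (fun μ => tvNorm_nonneg _) (fun μ => tvDist_le_card_mul_dist μ μ₀) ?_
  have : Continuous fun μ : stdSimplex ℝ X => Fintype.card X * dist μ μ₀ := by fun_prop
  simpa using this.tendsto μ₀

theorem continuous_of_abs_sub_le {M : Type*} [TopologicalSpace M] {F : M → ℝ} {b : M → M → ℝ}
    (hb : ∀ y, Tendsto (fun z => b z y) (𝓝 y) (𝓝 0)) (h : ∀ z y, |F z - F y| ≤ b z y) :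
    Continuous F :=
  continuous_iff_continuousAt.2 fun y => tendsto_iff_dist_tendsto_zero.2 <|
    squeeze_zero (fun _ => dist_nonneg) (fun z => h z y) (hb y)

theorem continuous_stdSimplex_apply (x : X) : Continuous fun μ : stdSimplex ℝ X => μ x :=
  (continuous_apply x).comp continuous_subtype_val

/-! ### Existence and uniqueness of equilibria. -/

section Kernel

variable {p : X → A → stdSimplex ℝ X → stdSimplex ℝ X} {α : (X → A → ℝ) → X → A} {Lp LQ β : ℝ}

theorem LipschitzAssumption.abs_transition_sub_le (hp : LipschitzAssumption p α Lp LQ)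
    (x x' : X) (μ₁ μ₂ : stdSimplex ℝ X) (Q₁ Q₂ : X → A → ℝ) :
    |transition p α Q₁ μ₁ x x' - transition p α Q₂ μ₂ x x'| ≤
      Lp * tvDist μ₁ μ₂ + LQ * ‖Q₁ - Q₂‖ :=
  (Finset.single_le_sum (f := fun x' => |transition p α Q₁ μ₁ x x' - transition p α Q₂ μ₂ x x'|)
    (fun _ _ => abs_nonneg _) (Finset.mem_univ x')).trans (hp.2.2.2 x μ₁ μ₂ Q₁ Q₂)

/-- The selector `α` may jump as `Q` varies; continuity comes from the joint Lipschitz bound on the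
composite kernel. -/
theorem LipschitzAssumption.continuous_transition (hp : LipschitzAssumption p α Lp LQ)
    {q : stdSimplex ℝ X → X → A → ℝ} (hq : Continuous q) (x x' : X) :
    Continuous fun μ => transition p α (q μ) μ x x' := by
  refine continuous_of_abs_sub_le (b := fun μ ν => Lp * tvDist μ ν + LQ * ‖q μ - q ν‖)
    (fun ν => ?_) fun μ ν => hp.abs_transition_sub_le x x' μ ν (q μ) (q ν)
  have h : Continuous fun μ => ‖q μ - q ν‖ := by fun_prop
  simpa using ((tendsto_tvDist ν).const_mul Lp).add ((h.tendsto ν).const_mul LQ)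

/-- Every action is the minimizer of some `Q`, so that the kernel itself is continuous in the
measure. -/
theorem LipschitzAssumption.continuous_kernel (hp : LipschitzAssumption p α Lp LQ)
    (hα : IsArgmin α) (x x' : X) (a : A) : Continuous fun μ => p x a μ x' := by
  classical
  let Q : X → A → ℝ := fun _ a' => if a' = a then 0 else 1
  have hQ : α Q x = a := by
    by_contra h
    have := hα Q x a
    simp only [Q, if_neg h, if_true] at this
    linarith
  have := hp.continuous_transition (q := fun _ => Q) continuous_const x x'
  simpa only [transition, hQ] using this

theorem LipschitzAssumption.exists_isEquilibrium [Nonempty X] (hp : LipschitzAssumption p α Lp LQ)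
    {q : stdSimplex ℝ X → X → A → ℝ} (hq : Continuous q) : ∃ μ, IsEquilibrium p α (q μ) μ := by
  let Φ : stdSimplex ℝ X → stdSimplex ℝ X := fun μ =>
    ⟨fun x => ∑ x₀, μ x₀ * transition p α (q μ) μ x₀ x,
      fun x => Finset.sum_nonneg fun x₀ _ =>
        mul_nonneg (stdSimplex.zero_le _ _) (stdSimplex.zero_le _ _), by
      rw [Finset.sum_comm]
      simp only [← Finset.mul_sum, transition, stdSimplex.sum_eq_one, mul_one]⟩
  have hΦ : Continuous Φ := by
    refine Continuous.subtype_mk (continuous_pi fun x => continuous_finsetSum _ fun x₀ _ => ?_) _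
    exact (continuous_stdSimplex_apply x₀).mul (hp.continuous_transition hq x₀ x)
  obtain ⟨μ, hμ⟩ := stdSimplex.exists_isFixedPt Φ hΦ
  exact ⟨μ, fun x => (DFunLike.congr_fun hμ x).symm⟩

/-- A Doeblin minorization makes a stochastic matrix contract zero-sum vectors in `ℓ¹`. -/
theorem sum_abs_sum_mul_le_of_doeblin {P : X → X → ℝ} (hP : ∀ x, ∑ x', P x x' = 1)
    {ν : stdSimplex ℝ X} (hν : ∀ x x', β * ν x' ≤ P x x') {v : X → ℝ} (hv : ∑ x, v x = 0) :
    ∑ x', |∑ x, v x * P x x'| ≤ (1 - β) * ∑ x, |v x| := by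
  have h1 : ∀ x', |∑ x, v x * P x x'| ≤ ∑ x, |v x| * (P x x' - β * ν x') := by
    intro x'
    have : ∑ x, v x * P x x' = ∑ x, v x * (P x x' - β * ν x') := by
      simp only [mul_sub, Finset.sum_sub_distrib, ← Finset.sum_mul, hv, zero_mul, sub_zero]
    rw [this]
    refine (Finset.abs_sum_le_sum_abs _ _).trans (Finset.sum_le_sum fun x _ => ?_)
    rw [abs_mul, abs_of_nonneg (sub_nonneg.2 (hν x x'))]
  refine (Finset.sum_le_sum fun x' _ => h1 x').trans ?_
  rw [Finset.sum_comm]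
  simp only [← Finset.mul_sum, Finset.sum_sub_distrib, hP, stdSimplex.sum_eq_one, mul_one,
    ← Finset.sum_mul]
  rw [mul_comm]

theorem LipschitzAssumption.isEquilibrium_unique (hp : LipschitzAssumption p α Lp LQ)
    (hβ : (1 + Lp) / 2 < β) {Q : X → A → ℝ} {π ν : stdSimplex ℝ X} (hπ : IsEquilibrium p α Q π)
    (hν : ∀ x x', β * ν x' ≤ transition p α Q π x x') {μ : stdSimplex ℝ X}
    (hμ : IsEquilibrium p α Q μ) : μ = π := by
  set v : X → ℝ := fun x => μ x - π x with hv
  have hv0 : ∑ x, v x = 0 := by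
    simp [hv, Finset.sum_sub_distrib, stdSimplex.sum_eq_one]
  -- `μP^μ - πP^π = (μ - π)P^π + μ(P^μ - P^π)`: Doeblin handles the first term, the Lipschitz bound
  -- the second.
  have hdec : ∀ x', v x' = ∑ x, v x * transition p α Q π x x' +
      ∑ x, μ x * (transition p α Q μ x x' - transition p α Q π x x') := by
    intro x'
    have h : v x' = _ := congrArg₂ (· - ·) (hμ x') (hπ x')
    rw [h, ← Finset.sum_sub_distrib, ← Finset.sum_add_distrib]
    exact Finset.sum_congr rfl fun x _ => by simp only [hv]; ring
  have h1 := sum_abs_sum_mul_le_of_doeblin (P := transition p α Q π)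
    (fun x => stdSimplex.sum_eq_one _) hν hv0
  have h2 : ∑ x', |∑ x, μ x * (transition p α Q μ x x' - transition p α Q π x x')| ≤
      Lp * tvNorm v := by
    calc ∑ x', |∑ x, μ x * (transition p α Q μ x x' - transition p α Q π x x')|
        ≤ ∑ x', ∑ x, μ x * |transition p α Q μ x x' - transition p α Q π x x'| := by
          refine Finset.sum_le_sum fun x' _ => (Finset.abs_sum_le_sum_abs _ _).trans ?_
          refine Finset.sum_le_sum fun x _ => ?_
          rw [abs_mul, abs_of_nonneg (stdSimplex.zero_le μ x)]
      _ = ∑ x, μ x * ∑ x', |transition p α Q μ x x' - transition p α Q π x x'| := by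
          rw [Finset.sum_comm]; simp only [Finset.mul_sum]
      _ ≤ ∑ x, μ x * (Lp * tvNorm v) := by
          refine Finset.sum_le_sum fun x _ =>
            mul_le_mul_of_nonneg_left ?_ (stdSimplex.zero_le μ x)
          have := hp.2.2.2 x μ π Q Q
          rwa [sub_self, norm_zero, mul_zero, add_zero] at this
      _ = Lp * tvNorm v := by rw [← Finset.sum_mul, stdSimplex.sum_eq_one, one_mul]
  have h3 : ∑ x, |v x| ≤ (1 - β) * ∑ x, |v x| + Lp * tvNorm v := by
    refine le_trans ?_ (add_le_add h1 h2)
    rw [← Finset.sum_add_distrib]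
    refine Finset.sum_le_sum fun x' _ => ?_
    conv_lhs => rw [hdec x']
    exact abs_add_le _ _
  have h4 := mul_le_mul_of_nonneg_left (two_mul_tvNorm_le hv0) hp.1.le
  have h5 : 0 ≤ ∑ x, |v x| := Finset.sum_nonneg fun _ _ => abs_nonneg _
  have h6 : ∑ x, |v x| = 0 := by
    by_contra hne
    have h7 := mul_pos (show 0 < β - Lp / 2 by linarith) (lt_of_le_of_ne h5 (Ne.symm hne))
    linarith
  refine DFunLike.ext _ _ fun x => sub_eq_zero.1 (abs_eq_zero.1 ?_)
  exact (Finset.sum_eq_zero_iff_of_nonneg fun _ _ => abs_nonneg _).1 h6 x (Finset.mem_univ x)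

end Kernel

/-! ### Bellman fixed points depending on the measure. -/

section Bellman

/-- The Bellman operator at a frozen measure. -/
noncomputable def bellman (p : X → A → stdSimplex ℝ X → stdSimplex ℝ X)
    (f : X → A → stdSimplex ℝ X → ℝ) (h γ : ℝ) (μ : stdSimplex ℝ X) (Q : X → A → ℝ) : X → A → ℝ :=
  fun x a => h * f x a μ + Real.exp (-(γ * h)) * ∑ x', p x a μ x' * ⨅ a', Q x' a'

theorem abs_iInf_sub_iInf_le [Nonempty A] (u v : A → ℝ) : |(⨅ a, u a) - ⨅ a, v a| ≤ dist u v := by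
  have key : ∀ u v : A → ℝ, (⨅ a, u a) - dist u v ≤ ⨅ a, v a := fun u v =>
    le_ciInf fun a => by
      have h1 := ciInf_le (Set.finite_range u).bddBelow a
      have h2 := (abs_le.1 (dist_le_pi_dist u v a)).2
      linarith
  have h1 := key u v
  have h2 := key v u
  rw [dist_comm] at h2
  rw [abs_le]
  constructor <;> linarith

variable {p : X → A → stdSimplex ℝ X → stdSimplex ℝ X} {f : X → A → stdSimplex ℝ X → ℝ} {h γ : ℝ}

theorem contractingWith_bellman [Nonempty A] (hh : 0 < h) (hγ : 0 < γ) (μ : stdSimplex ℝ X) :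
    ContractingWith (Real.exp (-(γ * h))).toNNReal (bellman p f h γ μ) := by
  refine ⟨by simp [mul_pos hγ hh], LipschitzWith.of_dist_le_mul fun Q₁ Q₂ => ?_⟩
  rw [Real.coe_toNNReal _ (Real.exp_pos _).le]
  have hb : 0 ≤ Real.exp (-(γ * h)) * dist Q₁ Q₂ := by positivity
  rw [dist_pi_le_iff hb]
  intro x
  rw [dist_pi_le_iff hb]
  intro a
  rw [Real.dist_eq, bellman, bellman, add_sub_add_left_eq_sub, ← mul_sub, abs_mul,
    abs_of_pos (Real.exp_pos _), ← Finset.sum_sub_distrib]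
  refine mul_le_mul_of_nonneg_left ((Finset.abs_sum_le_sum_abs _ _).trans ?_) (Real.exp_pos _).le
  calc ∑ x', |(p x a μ x' * ⨅ a', Q₁ x' a') - p x a μ x' * ⨅ a', Q₂ x' a'|
      ≤ ∑ x', p x a μ x' * dist Q₁ Q₂ := by
        refine Finset.sum_le_sum fun x' _ => ?_
        rw [← mul_sub, abs_mul, abs_of_nonneg (stdSimplex.zero_le _ _)]
        exact mul_le_mul_of_nonneg_left ((abs_iInf_sub_iInf_le _ _).trans
          (dist_le_pi_dist Q₁ Q₂ x')) (stdSimplex.zero_le _ _)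
    _ = dist Q₁ Q₂ := by rw [← Finset.sum_mul, stdSimplex.sum_eq_one, one_mul]

theorem CostAssumption.continuous {B : Type*} {f : X → B → stdSimplex ℝ X → ℝ} {Lμ : ℝ}
    (hf : CostAssumption f Lμ) (x : X) (a : B) :
    Continuous fun μ => f x a μ :=
  continuous_of_abs_sub_le (fun ν => by simpa using (tendsto_tvDist ν).const_mul Lμ)
    fun μ ν => hf.2.2 x a μ ν

theorem exists_continuous_isBellmanSolution [Nonempty A] (hh : 0 < h) (hγ : 0 < γ)
    (hp : ∀ x a x', Continuous fun μ => p x a μ x') (hf : ∀ x a, Continuous fun μ => f x a μ) :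
    ∃ q : stdSimplex ℝ X → X → A → ℝ, Continuous q ∧ ∀ μ, IsBellmanSolution p f h γ (q μ) μ := by
  have hB := contractingWith_bellman (p := p) (f := f) hh hγ
  refine ⟨fun μ => (hB μ).fixedPoint, ?_, fun μ x a =>
    (congrFun (congrFun (hB μ).fixedPoint_isFixedPt x) a).symm⟩
  rw [continuous_iff_continuousAt]
  intro μ₀
  set Q₀ := (hB μ₀).fixedPoint with hQ₀
  have hcont : Continuous fun μ => bellman p f h γ μ Q₀ :=
    continuous_pi fun x => continuous_pi fun a => ((hf x a).const_mul h).add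
      ((continuous_finsetSum _ fun x' _ => (hp x a x').mul_const _).const_mul _)
  -- The contraction factor is the same for all `μ`, so the distance from `Q₀` to the fixed point at
  -- `μ` is controlled by how far the operator at `μ` moves `Q₀`.
  refine tendsto_iff_dist_tendsto_zero.2 (squeeze_zero (fun _ => dist_nonneg)
    (fun μ => (dist_comm _ _).trans_le ((hB μ).dist_fixedPoint_le Q₀)) ?_)
  have h0 : dist Q₀ (bellman p f h γ μ₀ Q₀) = 0 := by
    rw [dist_eq_zero]; exact (hB μ₀).fixedPoint_isFixedPt.symm
  have := ((continuous_const.dist hcont).tendsto μ₀).div_const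
    (1 - ((Real.exp (-(γ * h))).toNNReal : ℝ)) (f := fun μ => dist Q₀ (bellman p f h γ μ Q₀))
  rwa [h0, zero_div] at this

end Bellman

end MeanFieldQ

theorem mainTheorem2 {X A : Type*} [Fintype X] [Nonempty X] [Fintype A] [Nonempty A]
    (p : X → A → stdSimplex ℝ X → stdSimplex ℝ X)
    (f : X → A → stdSimplex ℝ X → ℝ)
    (α : (X → A → ℝ) → X → A) (hα : MeanFieldQ.IsArgmin α)
    (h γ : ℝ) (hh : 0 < h) (hγ : 0 < γ)
    (Lp LQ β : ℝ)
    (hp : MeanFieldQ.LipschitzAssumption p α Lp LQ)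
    (hD : MeanFieldQ.DoeblinAssumption p α Lp β) :
    (∀ Q : X → A → ℝ, ∃! μ : stdSimplex ℝ X, MeanFieldQ.IsEquilibrium p α Q μ) ∧
    (∀ Lμ : ℝ, MeanFieldQ.CostAssumption f Lμ →
      ∃ (Q : X → A → ℝ) (μ : stdSimplex ℝ X),
        MeanFieldQ.IsBellmanSolution p f h γ Q μ ∧ MeanFieldQ.IsEquilibrium p α Q μ) := by
  refine ⟨fun Q => ?_, fun Lμ hf => ?_⟩
  · obtain ⟨π, hπ, ν, hν⟩ := hD.2.2 Q (hp.exists_isEquilibrium (q := fun _ => Q) continuous_const)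
    exact ⟨π, hπ, fun μ hμ => hp.isEquilibrium_unique hD.1 hπ hν hμ⟩
  · obtain ⟨q, hq, hqB⟩ := MeanFieldQ.exists_continuous_isBellmanSolution hh hγ
      (fun x a x' => hp.continuous_kernel hα x x' a) hf.continuous
    obtain ⟨μ, hμ⟩ := hp.exists_isEquilibrium hq
    exact ⟨q μ, μ, hqB μ, hμ⟩
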